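/- Let $L(x)=\sum_i L_i x^i$ and $R(x)=\sum_j R_j x^j$ be polynomials with nonnegative coefficients, $L(1)=R(1)=1$ and $L_0=R_0=0$ (degree distributions from the node perspective). Call $n\ge 1$ a blocklength if $nL_i$ and $mR_j$, where $m=nL'(1)/R'(1)$, are integers for all $i,j$, and assume that a blocklength exists (then there are infinitely many); below $n$ ranges over blocklengths. The $(n,L,R)$-irregular LDPC ensemble has $n$ variable nodes, $nL_i$ of them of degree $i$, and $m$ check nodes, $mR_j$ of them of degree $j$, a node of degree $k$ carrying $k$ sockets; its edge set is a uniformly random perfect matching (one of $E!$, $E=nL'(1)$) of the variable-node sockets with the check-node sockets. Let $\mathrm{P_b}(n,\epsilon,t)$ be the bit error probability of this ensemble over the binary erasure channel with erasure probability $\epsilon\in[0,1]$ after $t\ge 0$ belief-propagation iterations, i.e. the probability, averaged over the variable nodes and the edge set, that a bit is still erased. Fix $t$. Then for every $\epsilon\in[0,1]$ the limits $$\mathrm{P_b}(\infty,\epsilon,t):=\lim_{n\to\infty}\mathrm{P_b}(n,\epsilon,t),\qquad \alpha(\epsilon,t):=\lim_{n\to\infty}n\bigl(\mathrm{P_b}(n,\epsilon,t)-\mathrm{P_b}(\infty,\epsilon,t)\bigr)$$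 exist, and there is a function $D=D(n)$, depending on $t$ (and on $L,R$) but not on $\epsilon$, with $D(n)=\Theta(n^{-2})$ as $n\to\infty$, such that for all blocklengths $n$ and all $\epsilon\in[0,1]$ $$\left|\mathrm{P_b}(n,\epsilon,t)-\mathrm{P_b}(\infty,\epsilon,t)-\alpha(\epsilon,t)\frac1n\right|\le D(n).$$ Moreover, $\mathrm{P_b}(n,\epsilon,t)\to\mathrm{P_b}(\infty,\epsilon,t)$ as $n\to\infty$, uniformly in $\epsilon\in[0,1]$. -/

import Mathlib

open Filter Topology Polynomial

noncomputable section

namespace LDPC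

section TannerGraph

open scoped Classical

variable {V C : Type} (dv : V → ℕ) (dc : C → ℕ)

/-- Sockets of a family of nodes with prescribed degrees: node `v` carries `d v` sockets. -/
abbrev Socket {N : Type} (d : N → ℕ) : Type := Σ v : N, Fin (d v)

/-- The edge set of a Tanner graph on fixed nodes and sockets: a perfect matching of the
variable-node sockets with the check-node sockets (multiple edges are allowed).
The edge through the variable-node socket `s` is named by `s`. -/
abbrev EdgeSet : Type := Socket dv ≃ Socket dc

variable {dv dc}

/-- Belief propagation on the binary erasure channel, where `S` is the set of variable nodes whose
channel output is erased: the message sent along edge `e` from its check node to its variable node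
in iteration `t` is an erasure. (Before the first iteration it is.) The check node sends an erasure
iff one of its other edges `e'` brings an erasure, and the variable node sends an erasure along `e'`
iff its channel output is erased and all its other edges brought an erasure in the preceding
iteration. -/
def CheckMsgErased (σ : EdgeSet dv dc) (S : Finset V) : ℕ → Socket dv → Prop
  | 0, _ => True
  | t + 1, e => ∃ e' : Socket dv, e' ≠ e ∧ (σ e').1 = (σ e).1 ∧
      e'.1 ∈ S ∧ ∀ e'' : Socket dv, e'' ≠ e' → e''.1 = e'.1 → CheckMsgErased σ S t e''

/-- The bit of the variable node `v` is still erased after `t` iterations. -/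
def BitErased (σ : EdgeSet dv dc) (S : Finset V) (t : ℕ) (v : V) : Prop :=
  v ∈ S ∧ ∀ e : Socket dv, e.1 = v → CheckMsgErased σ S t e

/-- Bit error probability, after `t` iterations over the BEC with erasure probability `ε`, of the
code with Tanner graph `σ`: the average over the variable nodes of the probability that the
bit remains erased, the channel erasing the nodes independently with probability `ε`. -/
def codeBitError [Fintype V] (σ : EdgeSet dv dc) (ε : ℝ) (t : ℕ) : ℝ :=
  (∑ v : V, ∑ S : Finset V,
      if BitErased σ S t v then ε ^ S.card * (1 - ε) ^ (Fintype.card V - S.card) else 0) /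
    Fintype.card V

variable (dv dc) in
/-- Average of the bit error probability over the uniformly random edge set. -/
def ensembleBitError [Fintype V] [Fintype C] (ε : ℝ) (t : ℕ) : ℝ :=
  (∑ σ : EdgeSet dv dc, codeBitError σ ε t) / Fintype.card (EdgeSet dv dc)

end TannerGraph

/-- A degree distribution polynomial from the node perspective: the coefficient of `X ^ i` is the
fraction of nodes of degree `i`, and all degrees are at least one. -/
structure IsDegreeDistribution (p : ℝ[X]) : Prop where
  nonneg : ∀ i, 0 ≤ p.coeff i
  coeff_zero : p.coeff 0 = 0
  sum_one : p.eval 1 = 1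

/-- The number `m = n L'(1) / R'(1)` of check nodes. -/
def numChecks (L R : ℝ[X]) (n : ℕ) : ℝ :=
  n * (derivative L).eval 1 / (derivative R).eval 1

/-- `n` is a blocklength of the ensemble: the prescribed numbers `n L i` of variable nodes of degree
`i` and `m R j` of check nodes of degree `j` are integers. -/
structure IsBlocklength (L R : ℝ[X]) (n : ℕ) : Prop where
  pos : 0 < n
  var_int : ∀ i, ∃ k : ℕ, n * L.coeff i = k
  check_int : ∀ j, ∃ k : ℕ, numChecks L R n * R.coeff j = k

/-- The filter describing `n → ∞` along the blocklengths of the ensemble. -/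
def blocklengths (L R : ℝ[X]) : Filter ℕ := atTop ⊓ 𝓟 {n | IsBlocklength L R n}

/-- For each degree `i`, there are `a * p i` nodes of degree `i`
(this number is an integer whenever it is used). -/
abbrev Node (p : ℝ[X]) (a : ℝ) : Type := Σ i : p.support, Fin ⌊a * p.coeff i⌋₊

/-- The degree of a node. -/
def Node.deg {p : ℝ[X]} {a : ℝ} (v : Node p a) : ℕ := v.1

/-- The bit error probability of the `(n, L, R)`-irregular ensemble over the BEC with
erasure probability `ε` after `t` iterations. -/
def Pb (L R : ℝ[X]) (n : ℕ) (ε : ℝ) (t : ℕ) : ℝ :=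
  ensembleBitError (Node.deg : Node L n → ℕ) (Node.deg : Node R (numChecks L R n) → ℕ) ε t

/-- The large-blocklength limit of the bit error probability. -/
def PbInf (L R : ℝ[X]) (ε : ℝ) (t : ℕ) : ℝ :=
  limUnder (blocklengths L R) fun n => Pb L R n ε t

/-- The coefficient of `1 / n`: the limit of `n (Pb n - PbInf)`. -/
def alpha (L R : ℝ[X]) (ε : ℝ) (t : ℕ) : ℝ :=
  limUnder (blocklengths L R) fun n => (n : ℝ) * (Pb L R n ε t - PbInf L R ε t)

end LDPC

end

/-!
For a fixed number `t` of iterations, the bit error probability is, for large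
blocklengths `n`, a rational function of `n`. As it is bounded, it has an expansion in powers of
`1 / n`.

Only edges at erased variable nodes matter for the event that an erased bit stays erased: every edge
whose message is consulted lies at an erased node. On the multigraph of these edges, the indicator of
an erased message is *local*: it is a sum, over tuples of edges of a fixed length, of a function of
the coincidences in the tuple (equal edges, edges with a common variable node or check node). Local
functions form an algebra that is closed under summation over one of the edges. A property "some
neighbouring edge satisfies `P`" is a function of the number of such edges. This number is a local
function with boundedly many values, and interpolation by a polynomial shows that every function of
it is local again (`IsLocal.comp_nat`). Induction on `t` gives `EdgeGraph.isLocalPred_msg`, and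
dividing the event that a bit stays erased equally among the edges at its node turns the sum over the
nodes into a sum over edges (`sum_bitErased`).

Now the average over the channel and over the edge set can be taken for a fixed tuple. A set of `c`
variable nodes is erased with probability `ε ^ c`, and a partial matching of `r` edges extends to
`(E - r)!` of the `E!` perfect matchings. What remains is a sum over tuples of sockets on both sides
of a function of their coincidences, and this is a polynomial in the numbers of nodes of the various
degrees (`isPolyOn_sum_node`), which are proportional to `n`. Hence, for some `K`, the product of the
bit error probability with `n * E (E - 1) ⋯ (E - K + 1)` is a polynomial in `n` and `ε`
(`exists_isPolyOn_Pb`). As the probability lies between `0` and `1` for infinitely many `n`, this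
polynomial has degree at most `K + 1` in `n`. Its coefficients are bounded for `ε` in `[0, 1]`, so
that Taylor expansion at `1 / n = 0` gives the expansion with an error that is uniform in `ε`
(`exists_expansion`).
-/

/-! ### Local functions of edges of a multigraph -/

namespace LDPC

open scoped Classical

/-- A finite bipartite multigraph seen from its edges: `sameVar` and `sameCheck` say that two edges
share their variable node, or their check node. At most `Δ` edges share a node of
either kind with a given edge. The relations need not be equivalence relations, as only these bounds
are used. -/
structure EdgeGraph (Δ : ℕ) where
  Edge : Type
  [fintypeEdge : Fintype Edge]
  sameVar : Edge → Edge → Prop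
  sameCheck : Edge → Edge → Prop
  card_var_le : ∀ e, Fintype.card {e' // sameVar e' e} ≤ Δ
  card_check_le : ∀ e, Fintype.card {e' // sameCheck e' e} ≤ Δ

attribute [instance] EdgeGraph.fintypeEdge

/-- The possible coincidences in a tuple of edges indexed by `I`: which entries are equal, which
share their variable node, and which share their check node. -/
abbrev Pattern (I : Type) : Type := I → I → Prop × Prop × Prop

/-- The coincidences in the tuple `x` of edges. -/
def EdgeGraph.pattern {Δ : ℕ} (G : EdgeGraph Δ) {I : Type} (x : I → G.Edge) : Pattern I :=
  fun i j => (x i = x j, G.sameVar (x i) (x j), G.sameCheck (x i) (x j))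

/-- A real function of a tuple of edges of a multigraph is local if it is a sum, over auxiliary
edges whose number is the same for all multigraphs, of a function of the pattern of coincidences. -/
def IsLocal {Δ : ℕ} {I : Type} (g : ∀ G : EdgeGraph Δ, (I → G.Edge) → ℝ) : Prop :=
  ∃ (J : Type) (_ : Fintype J) (W : Pattern (I ⊕ J) → ℝ), ∀ (G : EdgeGraph Δ) (x : I → G.Edge),
    g G x = ∑ y : J → G.Edge, W (G.pattern (Sum.elim x y))

/-- Patterns are restricted along maps of the index types. -/
def Pattern.comap {I J : Type} (f : I → J) (p : Pattern J) : Pattern I := fun i j => p (f i) (f j)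

lemma EdgeGraph.pattern_comp {Δ : ℕ} (G : EdgeGraph Δ) {I J : Type} (f : I → J) (x : J → G.Edge) :
    G.pattern (x ∘ f) = (G.pattern x).comap f := rfl

lemma sum_sumArrow {X A B : Type} [Fintype X] [Fintype A] [Fintype B]
    [DecidableEq A] [DecidableEq B] {_ : DecidableEq (A ⊕ B)} (F : (A ⊕ B → X) → ℝ) :
    ∑ y, F y = ∑ y₁ : A → X, ∑ y₂ : B → X, F (Sum.elim y₁ y₂) := by
  rw [← Fintype.sum_prod_type']
  exact Fintype.sum_equiv (Equiv.sumArrowEquivProdArrow A B X) _ _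
    fun y => by simp [Equiv.sumArrowEquivProdArrow]

namespace IsLocal

variable {Δ : ℕ} {I : Type} {g h : ∀ G : EdgeGraph Δ, (I → G.Edge) → ℝ}

lemma of_pattern (W : Pattern I → ℝ) :
    IsLocal (fun (G : EdgeGraph Δ) (x : I → G.Edge) => W (G.pattern x)) := by
  refine ⟨Empty, inferInstance, fun p => W (p.comap Sum.inl), fun G x => ?_⟩
  simp only [Finset.univ_unique, Finset.sum_singleton, ← EdgeGraph.pattern_comp, Sum.elim_comp_inl]

lemma const (c : ℝ) : IsLocal (fun (G : EdgeGraph Δ) (_ : I → G.Edge) => c) :=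
  of_pattern fun _ => c

lemma mul (hg : IsLocal g) (hh : IsLocal h) : IsLocal (fun G x => g G x * h G x) := by
  obtain ⟨J, _, W, hW⟩ := hg
  obtain ⟨K, _, Z, hZ⟩ := hh
  refine ⟨J ⊕ K, inferInstance, fun p => W (p.comap (Sum.map id Sum.inl)) *
    Z (p.comap (Sum.map id Sum.inr)), fun G x => ?_⟩
  rw [sum_sumArrow]
  simp [hW, hZ, Finset.sum_mul_sum, Sum.elim_comp_map, ← EdgeGraph.pattern_comp]

/-- Sums of different numbers of auxiliary edges are brought to a common shape by auxiliary edges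
that are forced to repeat an entry of the tuple. -/
lemma add [Nonempty I] (hg : IsLocal g) (hh : IsLocal h) :
    IsLocal (fun G x => g G x + h G x) := by
  obtain ⟨J, _, W, hW⟩ := hg
  obtain ⟨K, _, Z, hZ⟩ := hh
  let i₀ : I := Classical.arbitrary I
  refine ⟨J ⊕ K, inferInstance, fun p =>
    W (p.comap (Sum.map id Sum.inl)) *
        (if ∀ k : K, (p (Sum.inr (Sum.inr k)) (Sum.inl i₀)).1 then 1 else 0) +
      Z (p.comap (Sum.map id Sum.inr)) *
        (if ∀ j : J, (p (Sum.inr (Sum.inl j)) (Sum.inl i₀)).1 then 1 else 0), fun G x => ?_⟩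
  have key : ∀ (A : Type) [Fintype A] {_ : DecidablePred fun y : A → G.Edge => ∀ a, y a = x i₀},
      ∑ y : A → G.Edge, (if ∀ a, y a = x i₀ then (1 : ℝ) else 0) = 1 := fun A _ _ => by
    simp only [← funext_iff (g := fun _ => x i₀)]
    simp
  rw [sum_sumArrow]
  beta_reduce
  rw [hW, hZ]
  simp only [← EdgeGraph.pattern_comp, Finset.sum_add_distrib, Sum.elim_comp_map, Function.comp_id,
    Sum.elim_comp_inl, Sum.elim_comp_inr]
  simp only [EdgeGraph.pattern, Sum.elim_inl, Sum.elim_inr]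
  congr 1
  · exact Finset.sum_congr rfl fun y _ => by
      rw [← Finset.mul_sum]
      exact ((congrArg _ (key K)).trans (mul_one _)).symm
  · rw [Finset.sum_comm]
    exact Finset.sum_congr rfl fun y _ => by
      rw [← Finset.mul_sum]
      exact ((congrArg _ (key J)).trans (mul_one _)).symm

lemma comap {I' : Type} (f : I → I') (hg : IsLocal g) :
    IsLocal (fun G (x : I' → G.Edge) => g G (x ∘ f)) := by
  obtain ⟨J, _, W, hW⟩ := hg
  refine ⟨J, inferInstance, fun p => W (p.comap (Sum.map f id)), fun G x => ?_⟩
  simp [hW, ← EdgeGraph.pattern_comp, Sum.elim_comp_map]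

lemma sum {g : ∀ G : EdgeGraph Δ, (I ⊕ Unit → G.Edge) → ℝ} (hg : IsLocal g) :
    IsLocal (fun G (x : I → G.Edge) => ∑ z, g G (Sum.elim x fun _ => z)) := by
  obtain ⟨J, _, W, hW⟩ := hg
  refine ⟨Unit ⊕ J, inferInstance, fun p => W (p.comap (Equiv.sumAssoc I Unit J)),
    fun G x => ?_⟩
  rw [sum_sumArrow]
  beta_reduce
  rw [← Equiv.sum_comp (Equiv.funUnique Unit G.Edge).symm]
  refine Finset.sum_congr rfl fun z _ => (hW _ _).trans <| Finset.sum_congr rfl fun y _ => ?_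
  rw [← EdgeGraph.pattern_comp]
  congr 2
  ext i
  rcases i with (i | i) | i <;> rfl

lemma eval [Nonempty I] (hg : IsLocal g) (p : ℝ[X]) : IsLocal (fun G x => p.eval (g G x)) := by
  induction p using Polynomial.induction_on' with
  | add p q hp hq => simpa only [eval_add] using hp.add hq
  | monomial n a =>
    simp only [eval_monomial]
    refine (const a).mul ?_
    induction n with
    | zero => simpa only [pow_zero] using const 1
    | succ n ih => simpa only [pow_succ] using ih.mul hg

/-- A polynomial interpolates any function of a local function with finitely many values. -/
lemma comp_nat [Nonempty I] (N : ℕ) (c : ∀ G : EdgeGraph Δ, (I → G.Edge) → ℕ)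
    (hc : ∀ G x, c G x ≤ N) (hg : IsLocal (fun G x => (c G x : ℝ))) (F : ℕ → ℝ) :
    IsLocal (fun G x => F (c G x)) := by
  let p := Lagrange.interpolate (Finset.range (N + 1)) (fun m : ℕ => (m : ℝ)) F
  refine (funext₂ fun G x => ?_ : (fun G x => F (c G x)) =
    fun (G : EdgeGraph Δ) (x : I → G.Edge) => p.eval (c G x : ℝ)) ▸ hg.eval p
  exact (Lagrange.eval_interpolate_at_node F (Nat.cast_injective.injOn)
    (Finset.mem_range.2 (Nat.lt_succ_of_le (hc G x)))).symm

end IsLocal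

/-- A property of tuples of edges is local if its indicator function is. -/
def IsLocalPred {Δ : ℕ} {I : Type} (P : ∀ G : EdgeGraph Δ, (I → G.Edge) → Prop) : Prop :=
  IsLocal (fun G x => if P G x then (1 : ℝ) else 0)

namespace IsLocalPred

variable {Δ : ℕ} {I : Type} {P Q : ∀ G : EdgeGraph Δ, (I → G.Edge) → Prop}

lemma of_pattern (W : Pattern I → Prop) :
    IsLocalPred (fun (G : EdgeGraph Δ) (x : I → G.Edge) => W (G.pattern x)) :=
  IsLocal.of_pattern fun p => if W p then 1 else 0

lemma and (hP : IsLocalPred P) (hQ : IsLocalPred Q) : IsLocalPred (fun G x => P G x ∧ Q G x) := by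
  unfold IsLocalPred at *
  convert hP.mul hQ using 3
  split_ifs <;> simp_all

lemma not [Nonempty I] (hP : IsLocalPred P) : IsLocalPred (fun G x => ¬ P G x) := by
  unfold IsLocalPred at *
  convert (IsLocal.const 1).add ((IsLocal.const (-1)).mul hP) using 3
  split_ifs <;> simp_all

lemma comap {I' : Type} (f : I → I') (hP : IsLocalPred P) :
    IsLocalPred (fun G (x : I' → G.Edge) => P G (x ∘ f)) :=
  IsLocal.comap f hP

lemma card [Nonempty I] {P : ∀ G : EdgeGraph Δ, (I ⊕ Unit → G.Edge) → Prop} (hP : IsLocalPred P)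
    (N : ℕ) (hN : ∀ G (x : I → G.Edge), (Finset.univ.filter fun z =>
      P G (Sum.elim x fun _ => z)).card ≤ N) (F : ℕ → ℝ) :
    IsLocal (fun G (x : I → G.Edge) => F (Finset.univ.filter fun z =>
      P G (Sum.elim x fun _ => z)).card) := by
  refine IsLocal.comp_nat N _ hN ?_ F
  convert IsLocal.sum hP using 3
  simp

/-- Whether some edge has a property is a function of the number of edges that have it. -/
lemma exists_of_card_le [Nonempty I] {P : ∀ G : EdgeGraph Δ, (I ⊕ Unit → G.Edge) → Prop}
    (hP : IsLocalPred P) (N : ℕ) (hN : ∀ G (x : I → G.Edge), (Finset.univ.filter fun z =>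
      P G (Sum.elim x fun _ => z)).card ≤ N) :
    IsLocalPred (fun G (x : I → G.Edge) => ∃ z, P G (Sum.elim x fun _ => z)) := by
  unfold IsLocalPred
  convert hP.card N hN (fun m => if m = 0 then 0 else 1) using 3 with G x
  by_cases h : ∃ z, P G (Sum.elim x fun _ => z)
  · rw [if_pos h, if_neg]
    obtain ⟨z, hz⟩ := h
    exact Finset.card_ne_zero_of_mem (Finset.mem_filter.2 ⟨Finset.mem_univ z, hz⟩)
  · rw [if_neg h, if_pos]
    rw [Finset.card_eq_zero, Finset.filter_eq_empty_iff]
    exact fun z _ hz => h ⟨z, hz⟩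

end IsLocalPred

namespace EdgeGraph

variable {Δ : ℕ}

lemma card_filter_var_le (G : EdgeGraph Δ) (e : G.Edge) (p : G.Edge → Prop)
    (hp : ∀ e', p e' → G.sameVar e' e) : (Finset.univ.filter p).card ≤ Δ :=
  (Finset.card_le_card (Finset.monotone_filter_right _ fun e' _ => hp e')).trans
    ((Fintype.card_subtype _).symm.le.trans (G.card_var_le e))

lemma card_filter_check_le (G : EdgeGraph Δ) (e : G.Edge) (p : G.Edge → Prop)
    (hp : ∀ e', p e' → G.sameCheck e' e) : (Finset.univ.filter p).card ≤ Δ :=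
  (Finset.card_le_card (Finset.monotone_filter_right _ fun e' _ => hp e')).trans
    ((Fintype.card_subtype _).symm.le.trans (G.card_check_le e))

/-- Belief propagation on the multigraph formed by the edges at erased variable nodes: the message
from the check node to the variable node along an edge is an erasure. The condition on the other
edges at a variable node is a negated existential statement, so that
`IsLocalPred.exists_of_card_le` applies to both quantifiers. -/
def Msg (G : EdgeGraph Δ) : ℕ → G.Edge → Prop
  | 0, _ => True
  | t + 1, e => ∃ e', (e' ≠ e ∧ G.sameCheck e' e) ∧
      ¬ ∃ e'', (e'' ≠ e' ∧ G.sameVar e'' e') ∧ ¬ G.Msg t e''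

lemma isLocalPred_msg (t : ℕ) :
    IsLocalPred (fun (G : EdgeGraph Δ) (x : Unit → G.Edge) => G.Msg t (x ())) := by
  induction t with
  | zero => exact IsLocalPred.of_pattern fun _ => True
  | succ t ih =>
    have inner : IsLocalPred (fun (G : EdgeGraph Δ) (x : Unit → G.Edge) =>
        ∃ e'', (e'' ≠ x () ∧ G.sameVar e'' (x ())) ∧ ¬ G.Msg t e'') :=
      IsLocalPred.exists_of_card_le
        (P := fun G (x : Unit ⊕ Unit → G.Edge) => (x (.inr ()) ≠ x (.inl ()) ∧
          G.sameVar (x (.inr ())) (x (.inl ()))) ∧ ¬ G.Msg t (x (.inr ())))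
        ((IsLocalPred.of_pattern fun p => ¬ (p (.inr ()) (.inl ())).1 ∧
          (p (.inr ()) (.inl ())).2.1).and (ih.comap fun _ => Sum.inr ()).not) Δ
        fun G x => G.card_filter_var_le (x ()) _ fun e' h => h.1.2
    exact IsLocalPred.exists_of_card_le
        (P := fun G (x : Unit ⊕ Unit → G.Edge) => (x (.inr ()) ≠ x (.inl ()) ∧
          G.sameCheck (x (.inr ())) (x (.inl ()))) ∧
          ¬ ∃ e'', (e'' ≠ x (.inr ()) ∧ G.sameVar e'' (x (.inr ()))) ∧ ¬ G.Msg t e'')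
        ((IsLocalPred.of_pattern fun p => ¬ (p (.inr ()) (.inl ())).1 ∧
          (p (.inr ()) (.inl ())).2.2).and (inner.comap fun _ => Sum.inr ()).not) Δ
        fun G x => G.card_filter_check_le (x ()) _ fun e' h => h.1.2

/-- The share of the edge `e` in the event that its variable node remains erased: dividing by the
degree makes the shares of the edges at a node add up to the indicator of the event. -/
noncomputable def erasureShare (G : EdgeGraph Δ) (t : ℕ) (e : G.Edge) : ℝ :=
  (if ∀ e', G.sameVar e' e → G.Msg t e' then 1 else 0) *
    ((Finset.univ.filter fun e' => G.sameVar e' e).card : ℝ)⁻¹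

lemma isLocal_erasureShare (t : ℕ) :
    IsLocal (fun (G : EdgeGraph Δ) (x : Unit → G.Edge) => G.erasureShare t (x ())) := by
  have h₁ : IsLocalPred (fun (G : EdgeGraph Δ) (x : Unit → G.Edge) =>
      ¬ ∃ e', G.sameVar e' (x ()) ∧ ¬ G.Msg t e') :=
    (IsLocalPred.exists_of_card_le
      (P := fun G (x : Unit ⊕ Unit → G.Edge) => G.sameVar (x (.inr ())) (x (.inl ())) ∧
        ¬ G.Msg t (x (.inr ())))
      ((IsLocalPred.of_pattern fun p => (p (.inr ()) (.inl ())).2.1).and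
        ((isLocalPred_msg t).comap fun _ => Sum.inr ()).not) Δ
      fun G x => G.card_filter_var_le (x ()) _ fun e' h => h.1).not
  have h₂ : IsLocal (fun (G : EdgeGraph Δ) (x : Unit → G.Edge) =>
      ((Finset.univ.filter fun e' => G.sameVar e' (x ())).card : ℝ)⁻¹) :=
    IsLocalPred.card (P := fun G (x : Unit ⊕ Unit → G.Edge) =>
      G.sameVar (x (.inr ())) (x (.inl ())))
      (IsLocalPred.of_pattern fun p => (p (Sum.inr ()) (Sum.inl ())).2.1) Δ
      (fun G x => G.card_filter_var_le (x ()) _ fun e' h => h) fun m => (m : ℝ)⁻¹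
  convert IsLocal.mul h₁ h₂ using 3 with G x
  simp [erasureShare]

/-- The sum of the erasure shares of all edges is a sum, over tuples of edges of a fixed length, of
a function of their pattern of coincidences. -/
lemma exists_sum_erasureShare (Δ t : ℕ) : ∃ (J : Type) (_ : Fintype J) (W : Pattern J → ℝ),
    ∀ G : EdgeGraph Δ, ∑ e, G.erasureShare t e = ∑ y : J → G.Edge, W (G.pattern y) := by
  obtain ⟨J, _, W, hW⟩ := isLocal_erasureShare (Δ := Δ) t
  refine ⟨Unit ⊕ J, inferInstance, W, fun G => ?_⟩
  rw [sum_sumArrow, ← Equiv.sum_comp (Equiv.funUnique Unit G.Edge).symm]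
  exact Finset.sum_congr rfl fun e _ => hW G fun _ => e

end EdgeGraph

end LDPC

/-! ### Bit erasures as sums over tuples of edges -/

namespace LDPC

open scoped Classical

/-- The number of distinct rows of a relation. For the kernel of a tuple this is the number of
distinct entries of the tuple. -/
noncomputable def numClasses {J : Type} [Fintype J] (κ : J → J → Prop) : ℕ :=
  (Finset.univ.image κ).card

lemma numClasses_ker {J X : Type} [Fintype J] (f : J → X) :
    numClasses (fun i j => f i = f j) = (Finset.univ.image f).card := by
  let ψ : X → J → Prop := fun a j => a = f j
  have : (Finset.univ.image fun i j => f i = f j) = (Finset.univ.image f).image ψ := by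
    rw [Finset.image_image]
    rfl
  rw [numClasses, this]
  refine Finset.card_image_of_injOn fun a ha b hb hab => ?_
  obtain ⟨i, -, rfl⟩ := Finset.mem_image.1 (Finset.mem_coe.1 ha)
  exact ((congrFun hab i).mp rfl).symm

lemma numClasses_le {J : Type} [Fintype J] (κ : J → J → Prop) :
    numClasses κ ≤ Fintype.card J :=
  Finset.card_image_le

/-- A sum over `A` is a sum over `J` in which the value at `a` is divided equally among the indices
that are mapped to `a`. -/
lemma sum_eq_sum_div_card_fiber {A J : Type} [Fintype A] [Fintype J] (v : J → A) (H : A → ℝ)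
    (hH : ∀ a, (∀ j, v j ≠ a) → H a = 0) :
    ∑ a, H a = ∑ j, H (v j) / (Finset.univ.filter fun i => v i = v j).card := by
  rw [← Finset.sum_fiberwise Finset.univ v]
  refine Finset.sum_congr rfl fun a _ => ?_
  have hc : ∀ j ∈ Finset.univ.filter (fun j => v j = a),
      H (v j) / ((Finset.univ.filter fun i => v i = v j).card : ℝ) =
        H a / (Finset.univ.filter fun i => v i = a).card := fun j hj => by
    rw [(Finset.mem_filter.1 hj).2]
  rw [Finset.sum_congr rfl hc, Finset.sum_const, nsmul_eq_mul]
  by_cases ha : ∃ j, v j = a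
  · obtain ⟨j, hj⟩ := ha
    have : ((Finset.univ.filter fun i => v i = a).card : ℝ) ≠ 0 :=
      Nat.cast_ne_zero.2 (Finset.card_ne_zero_of_mem (Finset.mem_filter.2 ⟨Finset.mem_univ j, hj⟩))
    field_simp
  · rw [hH a fun j hj => ha ⟨j, hj⟩]
    simp

/-- The probability that all nodes in `A` are erased is `ε ^ A.card`. -/
lemma sum_superset_bernoulli {V : Type} [Fintype V] (A : Finset V) (ε : ℝ) :
    ∑ S : Finset V, (if A ⊆ S then ε ^ S.card * (1 - ε) ^ (Fintype.card V - S.card) else 0) =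
      ε ^ A.card := by
  have h := Finset.prod_add (fun _ : V => ε) (fun i => if i ∈ A then 0 else 1 - ε) Finset.univ
  rw [Finset.powerset_univ] at h
  trans ∏ i : V, (ε + if i ∈ A then (0 : ℝ) else 1 - ε)
  · refine Eq.trans ?_ h.symm
    refine Finset.sum_congr rfl fun S _ => ?_
    rw [Finset.prod_const]
    split_ifs with hS
    · congr 1
      rw [← Finset.card_univ, ← Finset.card_sdiff_of_subset (Finset.subset_univ S),
        ← Finset.prod_const]
      exact Finset.prod_congr rfl fun i hi =>
        (if_neg fun hA => (Finset.mem_sdiff.1 hi).2 (hS hA)).symm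
    · obtain ⟨i, hA, hi⟩ := Finset.not_subset.1 hS
      have hi' : i ∈ Finset.univ \ S := Finset.mem_sdiff.2 ⟨Finset.mem_univ i, hi⟩
      symm
      apply mul_eq_zero_of_right
      exact Finset.prod_eq_zero hi' (if_pos hA)
  · have : ∀ i : V, (ε + if i ∈ A then (0 : ℝ) else 1 - ε) = if i ∈ A then ε else 1 := fun i => by
      split_ifs <;> ring
    simp only [this, Finset.prod_ite_mem, Finset.univ_inter, Finset.prod_const]

/-- A partial matching with `r` edges extends to `(E - r)!` perfect matchings. -/
lemma card_equiv_extending {X Y J : Type} [Fintype X] [Fintype Y] [Fintype J]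
    (hXY : Fintype.card X = Fintype.card Y) (y : J → X) (z : J → Y)
    (h : ∀ i j, y i = y j ↔ z i = z j) :
    Fintype.card {σ : X ≃ Y // ∀ j, σ (y j) = z j} =
      (Fintype.card X - (Finset.univ.image y).card).factorial := by
  let g : Set.range y → Set.range z := fun x => ⟨z x.2.choose, Set.mem_range_self _⟩
  have hg : ∀ j, g ⟨y j, Set.mem_range_self j⟩ = ⟨z j, Set.mem_range_self j⟩ := fun j =>
    Subtype.ext ((h _ _).1 (Exists.choose_spec (⟨j, rfl⟩ : ∃ i, y i = y j)))
  have hbij : Function.Bijective g := by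
    constructor
    · rintro ⟨_, i, rfl⟩ ⟨_, j, rfl⟩ hij
      rw [hg, hg] at hij
      exact Subtype.ext ((h i j).2 (congrArg Subtype.val hij))
    · rintro ⟨_, j, rfl⟩
      exact ⟨_, hg j⟩
  let e₀ := Equiv.ofBijective g hbij
  have e₁ : {σ : X ≃ Y // ∀ j, σ (y j) = z j} ≃ {σ : X ≃ Y // ∀ x : Set.range y, σ x = e₀ x} :=
    Equiv.subtypeEquivRight fun σ => by
      constructor
      · rintro hσ ⟨_, j, rfl⟩
        exact (hσ j).trans (congrArg Subtype.val (hg j)).symm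
      · intro hσ j
        exact (hσ ⟨y j, Set.mem_range_self j⟩).trans (congrArg Subtype.val (hg j))
  have cy : Fintype.card (Set.range y) = (Finset.univ.image y).card := by
    rw [← Set.toFinset_card, Set.toFinset_range]
  have c₁ : Fintype.card ((Set.range y)ᶜ : Set X) =
      Fintype.card X - (Finset.univ.image y).card := by
    rw [Fintype.card_compl_set, cy]
  have c₂ : Fintype.card ((Set.range z)ᶜ : Set Y) =
      Fintype.card X - (Finset.univ.image y).card := by
    rw [Fintype.card_compl_set, ← Fintype.card_congr e₀, cy, hXY]
  rw [Fintype.card_congr (e₁.trans (Equiv.Set.compl e₀)),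
    Fintype.card_equiv (Fintype.equivOfCardEq (c₁.trans c₂.symm)), c₁]

/-- Summing a function of the images of a tuple of sockets over all perfect matchings. -/
lemma sum_equiv_comp {X Y J : Type} [Fintype X] [Fintype Y] [Fintype J] [Fintype (X ≃ Y)]
    (hXY : Fintype.card X = Fintype.card Y) (y : J → X) (F : (J → Y) → ℝ) :
    ∑ σ : X ≃ Y, F (σ ∘ y) = ∑ z : J → Y,
      if (fun i j => y i = y j) = (fun i j => z i = z j) then
        ((Fintype.card X - numClasses fun i j => y i = y j).factorial : ℝ) * F z else 0 := by
  rw [← Finset.sum_fiberwise Finset.univ fun σ : X ≃ Y => (σ ∘ y : J → Y)]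
  refine Finset.sum_congr rfl fun z _ => ?_
  rw [Finset.sum_congr rfl fun σ hσ => by rw [(Finset.mem_filter.1 hσ).2], Finset.sum_const,
    nsmul_eq_mul]
  split_ifs with h
  · rw [numClasses_ker, ← card_equiv_extending hXY y z fun i j => iff_of_eq (congrFun₂ h i j),
      Fintype.card_subtype]
    simp only [funext_iff, Function.comp_apply]
  · rw [Finset.card_eq_zero.2, Nat.cast_zero, zero_mul]
    refine Finset.filter_eq_empty_iff.2 fun σ _ hσ => h ?_
    subst hσ
    ext i j
    simp

section Bridge

variable {V C : Type} {dv : V → ℕ} {dc : C → ℕ}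

lemma card_fiber_le {A N : Type} [Fintype A] {d : N → ℕ} {f : A → Socket d}
    (hf : Function.Injective f) (v : N) : Fintype.card {a // (f a).1 = v} ≤ d v := by
  rw [← Fintype.card_fin (d v)]
  refine Fintype.card_le_of_injective (fun a => Fin.cast (congrArg d a.2) (f a.1).2) ?_
  rintro ⟨a, rfl⟩ ⟨b, hb⟩ h
  refine Subtype.ext (hf (Sigma.ext hb.symm ?_))
  exact (Fin.heq_ext_iff (congrArg d hb.symm)).2 (congrArg Fin.val h)

/-- The multigraph formed by the edges at erased variable nodes. -/
noncomputable def erasedGraph [Fintype V] {Δ : ℕ} (hv : ∀ v, dv v ≤ Δ)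
    (hc : ∀ c, dc c ≤ Δ) (σ : EdgeSet dv dc) (S : Finset V) : EdgeGraph Δ where
  Edge := {e : Socket dv // e.1 ∈ S}
  sameVar e' e := e'.1.1 = e.1.1
  sameCheck e' e := (σ e'.1).1 = (σ e.1).1
  card_var_le e := (card_fiber_le Subtype.val_injective e.1.1).trans (hv _)
  card_check_le e :=
    (card_fiber_le (σ.injective.comp Subtype.val_injective) (σ e.1).1).trans (hc _)

lemma checkMsgErased_iff [Fintype V] {Δ : ℕ} (hv : ∀ v, dv v ≤ Δ)
    (hc : ∀ c, dc c ≤ Δ) (σ : EdgeSet dv dc) (S : Finset V) (t : ℕ)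
    (e : {e : Socket dv // e.1 ∈ S}) :
    CheckMsgErased σ S t e.1 ↔ (erasedGraph hv hc σ S).Msg t e := by
  induction t generalizing e with
  | zero => exact Iff.rfl
  | succ t ih =>
    change _ ↔ ∃ e' : {e : Socket dv // e.1 ∈ S}, (e' ≠ e ∧ (σ e'.1).1 = (σ e.1).1) ∧
      ¬ ∃ e'' : {e : Socket dv // e.1 ∈ S}, (e'' ≠ e' ∧ e''.1.1 = e'.1.1) ∧
        ¬ (erasedGraph hv hc σ S).Msg t e''
    rw [CheckMsgErased]
    constructor
    · rintro ⟨e', hne, hc', hS, h⟩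
      refine ⟨⟨e', hS⟩, ⟨fun h => hne (congrArg Subtype.val h), hc'⟩, ?_⟩
      rintro ⟨e'', ⟨hne', hv'⟩, hm⟩
      exact hm ((ih e'').1 (h e''.1 (fun h => hne' (Subtype.ext h)) hv'))
    · rintro ⟨e', ⟨hne, hc'⟩, h⟩
      refine ⟨e'.1, fun h => hne (Subtype.ext h), hc', e'.2, fun e'' hne' hv' => ?_⟩
      by_contra hm
      have hS : e''.1 ∈ S := hv' ▸ e'.2
      exact h ⟨⟨e'', hS⟩, ⟨fun h => hne' (congrArg Subtype.val h), hv'⟩,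
        fun hm' => hm ((ih ⟨e'', hS⟩).2 hm')⟩

lemma sum_bitErased [Fintype V] {Δ : ℕ} (hv : ∀ v, dv v ≤ Δ) (hv₀ : ∀ v, 0 < dv v)
    (hc : ∀ c, dc c ≤ Δ) (σ : EdgeSet dv dc) (S : Finset V) (t : ℕ) :
    ∑ v, (if BitErased σ S t v then (1 : ℝ) else 0) =
      ∑ e, (erasedGraph hv hc σ S).erasureShare t e := by
  rw [sum_eq_sum_div_card_fiber (J := (erasedGraph hv hc σ S).Edge)
    (fun e : {e : Socket dv // e.1 ∈ S} => e.1.1)]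
  · refine Finset.sum_congr rfl fun e _ => ?_
    rw [EdgeGraph.erasureShare, div_eq_mul_inv]
    congr 2
    refine propext ⟨fun h e' he' => ?_, fun h => ⟨e.2, fun e' he' => ?_⟩⟩
    · exact (checkMsgErased_iff hv hc σ S t e').1 (h.2 e'.1 he')
    · have hS : e'.1 ∈ S := he' ▸ e.2
      exact (checkMsgErased_iff hv hc σ S t ⟨e', hS⟩).2 (h ⟨e', hS⟩ he')
  · intro v hve
    refine if_neg fun h => ?_
    exact hve ⟨⟨v, ⟨0, hv₀ v⟩⟩, h.1⟩ rfl

/-- The bit error probability of a code is a sum over tuples of edges whose length depends only on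
the number of iterations and on the maximal degree. -/
lemma exists_codeBitError_eq (Δ t : ℕ) : ∃ (J : Type) (_ : Fintype J) (W : Pattern J → ℝ),
    ∀ {V C : Type} [Fintype V] [Fintype C] {dv : V → ℕ} {dc : C → ℕ}, (∀ v, dv v ≤ Δ) →
      (∀ v, 0 < dv v) → (∀ c, dc c ≤ Δ) → ∀ (σ : EdgeSet dv dc) (ε : ℝ),
      codeBitError σ ε t = (∑ y : J → Socket dv,
        W (fun i j => (y i = y j, (y i).1 = (y j).1, (σ (y i)).1 = (σ (y j)).1)) *
          ε ^ numClasses fun i j => (y i).1 = (y j).1) / Fintype.card V := by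
  obtain ⟨J, _, W, hW⟩ := EdgeGraph.exists_sum_erasureShare Δ t
  refine ⟨J, inferInstance, W, fun {V C} _ _ {dv dc} hv hv₀ hc σ ε => ?_⟩
  rw [codeBitError]
  congr 1
  have hS : ∀ S : Finset V, ∑ v, (if BitErased σ S t v then (1 : ℝ) else 0) =
      ∑ y : J → Socket dv, if (Finset.univ.image fun j => (y j).1) ⊆ S then
        W (fun i j => (y i = y j, (y i).1 = (y j).1, (σ (y i)).1 = (σ (y j)).1)) else 0 := by
    intro S
    rw [sum_bitErased hv hv₀ hc, hW, ← Finset.sum_filter, Finset.sum_subtype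
      (p := fun y : J → Socket dv => ∀ j, (y j).1 ∈ S)
      (Finset.univ.filter fun y : J → Socket dv => (Finset.univ.image fun j => (y j).1) ⊆ S)
      (fun y => by simp [Finset.image_subset_iff])]
    refine Fintype.sum_equiv (Equiv.subtypePiEquivPi
      (p := fun (_ : J) (e : Socket dv) => e.1 ∈ S)).symm _ _ fun y => ?_
    congr 1
    funext i j
    simp only [EdgeGraph.pattern]
    congr 1
    exact propext Subtype.ext_iff
  -- For a fixed tuple, sum over the sets of erased nodes that contain its variable nodes.
  rw [Finset.sum_comm]
  trans ∑ S : Finset V, ∑ y : J → Socket dv,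
      W (fun i j => (y i = y j, (y i).1 = (y j).1, (σ (y i)).1 = (σ (y j)).1)) *
      if (Finset.univ.image fun j => (y j).1) ⊆ S then
        ε ^ S.card * (1 - ε) ^ (Fintype.card V - S.card) else 0
  · refine Finset.sum_congr rfl fun S _ => ?_
    trans (∑ v, if BitErased σ S t v then (1 : ℝ) else 0) *
      (ε ^ S.card * (1 - ε) ^ (Fintype.card V - S.card))
    · simp only [Finset.sum_mul, ite_mul, one_mul, zero_mul]
    · rw [hS, Finset.sum_mul]
      refine Finset.sum_congr rfl fun y _ => ?_
      split_ifs <;> simp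
  · rw [Finset.sum_comm]
    refine Finset.sum_congr rfl fun y _ => ?_
    rw [← Finset.mul_sum, sum_superset_bernoulli, numClasses_ker]

end Bridge

end LDPC

/-! ### Polynomial dependence of sums over nodes and sockets -/

namespace LDPC

open scoped Classical

/-- On the set `B` of integers `n`, the function `q n ε` is a polynomial in `n` and `ε`. The outer
variable of the polynomial stands for `n`. -/
def IsPolyOn (B : Set ℕ) (q : ℕ → ℝ → ℝ) : Prop :=
  ∃ p : ℝ[X][X], ∀ n ∈ B, ∀ ε, q n ε = p.evalEval ε n

namespace IsPolyOn

variable {B : Set ℕ} {q q' : ℕ → ℝ → ℝ}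

lemma const (c : ℝ) : IsPolyOn B fun _ _ => c :=
  ⟨C (C c), fun n _ ε => (evalEval_CC ε n c).symm⟩

lemma natCast : IsPolyOn B fun n _ => (n : ℝ) :=
  ⟨X, fun n _ ε => (evalEval_X ε n).symm⟩

lemma pow_right (k : ℕ) : IsPolyOn B fun _ ε => ε ^ k :=
  ⟨C (X ^ k), fun n _ ε => by rw [evalEval_C, eval_pow, eval_X]⟩

lemma add (h : IsPolyOn B q) (h' : IsPolyOn B q') : IsPolyOn B fun n ε => q n ε + q' n ε := by
  obtain ⟨p, hp⟩ := h
  obtain ⟨p', hp'⟩ := h'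
  exact ⟨p + p', fun n hn ε => by
    rw [evalEval_add, ← hp n hn, ← hp' n hn]⟩

lemma mul (h : IsPolyOn B q) (h' : IsPolyOn B q') : IsPolyOn B fun n ε => q n ε * q' n ε := by
  obtain ⟨p, hp⟩ := h
  obtain ⟨p', hp'⟩ := h'
  exact ⟨p * p', fun n hn ε => by
    rw [evalEval_mul, ← hp n hn, ← hp' n hn]⟩

lemma sub (h : IsPolyOn B q) (h' : IsPolyOn B q') : IsPolyOn B fun n ε => q n ε - q' n ε := by
  obtain ⟨p, hp⟩ := h
  obtain ⟨p', hp'⟩ := h'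
  exact ⟨p - p', fun n hn ε => by
    rw [evalEval_sub, ← hp n hn, ← hp' n hn]⟩

lemma sum {ι : Type} {s : Finset ι} {q : ι → ℕ → ℝ → ℝ} (h : ∀ i ∈ s, IsPolyOn B (q i)) :
    IsPolyOn B fun n ε => ∑ i ∈ s, q i n ε := by
  induction s using Finset.induction_on with
  | empty => simpa only [Finset.sum_empty] using const 0
  | insert a s ha ih =>
    simp only [Finset.sum_insert ha]
    exact (h a (Finset.mem_insert_self a s)).add (ih fun i hi => h i (Finset.mem_insert_of_mem hi))

lemma congr (h : IsPolyOn B q) (hq : ∀ n ∈ B, ∀ ε, q' n ε = q n ε) : IsPolyOn B q' := by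
  obtain ⟨p, hp⟩ := h
  exact ⟨p, fun n hn ε => (hq n hn ε).trans (hp n hn ε)⟩

lemma eval (h : IsPolyOn B q) (P : ℝ[X]) : IsPolyOn B fun n ε => P.eval (q n ε) := by
  induction P using Polynomial.induction_on' with
  | add P Q hP hQ => simpa only [eval_add] using hP.add hQ
  | monomial k a =>
    simp only [eval_monomial]
    refine (const a).mul ?_
    induction k with
    | zero => simpa only [pow_zero] using const 1
    | succ k ih => simpa only [pow_succ] using ih.mul h

lemma descFactorial {E : ℕ → ℕ} (hE : IsPolyOn B fun n _ => (E n : ℝ)) (r k : ℕ)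
    (hr : ∀ n ∈ B, r ≤ E n) : IsPolyOn B fun n _ => ((E n - r).descFactorial k : ℝ) :=
  ((hE.sub (const (r : ℝ))).eval (descPochhammer ℝ k)).congr fun n hn _ => by
    rw [← Nat.cast_sub (hr n hn), descPochhammer_eval_eq_descFactorial]

end IsPolyOn

/-- The relation on `Fin (k + 1)` that extends `κ` by a new first element, which is related to
itself and to the elements of `r`. -/
def consRel {k : ℕ} (r : Fin k → Prop) (κ : Fin k → Fin k → Prop) :
    Fin (k + 1) → Fin (k + 1) → Prop :=
  Fin.cons (Fin.cons True r) fun i => Fin.cons (r i) (κ i)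

lemma ker_cons {k : ℕ} {A : Type} (a : A) (v : Fin k → A) :
    (fun i j => (Fin.cons a v : Fin (k + 1) → A) i = (Fin.cons a v : Fin (k + 1) → A) j) =
      consRel (fun j => a = v j) fun i j => v i = v j := by
  funext i j
  refine Fin.cases ?_ (fun i => ?_) i <;> refine Fin.cases ?_ (fun j => ?_) j <;>
    simp [consRel, eq_comm]

section Counting

variable {B : Set ℕ} {D : Type} [Fintype D] {N : ℕ → D → ℕ}

/-- `isPolyOn_sum_node` for tuples indexed by `Fin k`, by induction on `k`. -/
lemma isPolyOn_sum_node_fin (hN : ∀ d, IsPolyOn B fun n _ => (N n d : ℝ)) (k : ℕ)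
    (Θ : (Fin k → Fin k → Prop) → (Fin k → D) → ℕ → ℝ → ℝ) (hΘ : ∀ κ δ, IsPolyOn B (Θ κ δ)) :
    IsPolyOn B fun n ε => ∑ v : Fin k → Σ d, Fin (N n d),
      Θ (fun i j => v i = v j) (fun i => (v i).1) n ε := by
  induction k with
  | zero =>
    refine (hΘ (fun i => i.elim0) (fun i => i.elim0)).congr fun n _ ε => ?_
    rw [Finset.univ_unique, Finset.sum_singleton]
    exact congrFun₂ (congrArg₂ Θ (funext fun i => i.elim0) (funext fun i => i.elim0)) n ε
  | succ k ih =>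
    -- The first node either repeats one of the others or has a class of its own.
    let Ξ : (Fin k → Fin k → Prop) → (Fin k → D) → ℕ → ℝ → ℝ := fun κ δ n ε =>
      ∑ d, (N n d : ℝ) * Θ (consRel (fun _ => False) κ) (Fin.cons d δ) n ε +
      ∑ j, (Θ (consRel (fun i => κ j i) κ) (Fin.cons (δ j) δ) n ε -
        Θ (consRel (fun _ => False) κ) (Fin.cons (δ j) δ) n ε) *
          ((Finset.univ.filter fun i => κ i j).card : ℝ)⁻¹
    have hΞ : ∀ κ δ, IsPolyOn B (Ξ κ δ) := fun κ δ =>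
      (IsPolyOn.sum fun d _ => (hN d).mul (hΘ _ _)).add
        (IsPolyOn.sum fun j _ => ((hΘ _ _).sub (hΘ _ _)).mul (IsPolyOn.const _))
    refine (ih Ξ hΞ).congr fun n _ ε => ?_
    rw [← Equiv.sum_comp (Fin.consEquiv fun _ => Σ d, Fin (N n d)), Fintype.sum_prod_type_right]
    refine Finset.sum_congr rfl fun v _ => ?_
    have h := sum_eq_sum_div_card_fiber v
      (fun a => Θ (consRel (fun j => a = v j) fun i j => v i = v j)
          (Fin.cons a.1 fun i => (v i).1) n ε -
        Θ (consRel (fun _ => False) fun i j => v i = v j) (Fin.cons a.1 fun i => (v i).1) n ε)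
      (fun a ha => by
        have : (fun j => a = v j) = fun _ => False :=
          funext fun j => eq_false fun h => ha j h.symm
        rw [this, sub_self])
    rw [Finset.sum_sub_distrib, sub_eq_iff_eq_add'] at h
    trans ∑ a, Θ (consRel (fun j => a = v j) fun i j => v i = v j)
          (Fin.cons a.1 fun i => (v i).1) n ε
    · refine Finset.sum_congr rfl fun a _ => ?_
      have h₂ : (fun i => ((Fin.cons a v : Fin (k + 1) → Σ d, Fin (N n d)) i).1) =
          (Fin.cons a.1 fun i => (v i).1 : Fin (k + 1) → D) :=
        funext fun i => by refine Fin.cases ?_ (fun i => ?_) i <;> simp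
      exact congrFun₂ (congrArg₂ Θ (ker_cons a v) h₂) n ε
    · rw [h, Fintype.sum_sigma]
      simp only [Finset.sum_const, Finset.card_univ, Fintype.card_fin, nsmul_eq_mul, div_eq_mul_inv]
      rfl

/-- A sum over tuples of nodes is a polynomial in the numbers of nodes of the various degrees, if
the summand depends only on coincidences in the tuple and on the degrees. -/
lemma isPolyOn_sum_node (hN : ∀ d, IsPolyOn B fun n _ => (N n d : ℝ)) {J : Type} [Fintype J]
    (Θ : (J → J → Prop) → (J → D) → ℕ → ℝ → ℝ) (hΘ : ∀ κ δ, IsPolyOn B (Θ κ δ)) :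
    IsPolyOn B fun n ε => ∑ v : J → Σ d, Fin (N n d),
      Θ (fun i j => v i = v j) (fun i => (v i).1) n ε := by
  let e := Fintype.equivFin J
  refine (isPolyOn_sum_node_fin hN (Fintype.card J)
    (fun κ δ => Θ (fun i j => κ (e i) (e j)) fun i => δ (e i)) fun κ δ => hΘ _ _).congr
    fun n _ ε => ?_
  exact Fintype.sum_equiv (Equiv.arrowCongr e (Equiv.refl _)) _ _ fun v => by
    simp [Equiv.arrowCongr]

/-- The version of `isPolyOn_sum_node` for tuples of sockets. -/
lemma isPolyOn_sum_socket (hN : ∀ d, IsPolyOn B fun n _ => (N n d : ℝ)) (deg : D → ℕ)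
    {J : Type} [Fintype J] (Θ : (J → J → Prop) → (J → J → Prop) → ℕ → ℝ → ℝ)
    (hΘ : ∀ κ κ', IsPolyOn B (Θ κ κ')) :
    IsPolyOn B fun n ε => ∑ y : J → Socket (fun v : Σ d, Fin (N n d) => deg v.1),
      Θ (fun i j => y i = y j) (fun i j => (y i).1 = (y j).1) n ε := by
  refine (isPolyOn_sum_node hN (fun κ δ n ε => ∑ s : ∀ i : J, Fin (deg (δ i)),
    Θ (fun i j => κ i j ∧ (s i : ℕ) = s j) κ n ε)
    fun κ δ => IsPolyOn.sum fun s _ => hΘ _ _).congr fun n _ ε => ?_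
  -- A tuple of sockets is a tuple of nodes together with a choice of a socket at each of them.
  let e : (J → Socket (fun v : Σ d, Fin (N n d) => deg v.1)) ≃
      Σ v : J → Σ d, Fin (N n d), ∀ i : J, Fin (deg (v i).1) :=
    { toFun := fun y => ⟨fun i => (y i).1, fun i => (y i).2⟩
      invFun := fun p i => ⟨p.1 i, p.2 i⟩ }
  rw [← Equiv.sum_comp e.symm, Fintype.sum_sigma]
  refine Finset.sum_congr rfl fun v _ => Finset.sum_congr rfl fun s _ => ?_
  have h : (fun i j => e.symm ⟨v, s⟩ i = e.symm ⟨v, s⟩ j) =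
      fun i j => v i = v j ∧ (s i : ℕ) = s j := by
    funext i j
    refine propext ⟨fun h => ?_, fun ⟨h₁, h₂⟩ => Sigma.ext h₁ ?_⟩
    · exact ⟨congrArg Sigma.fst h, congrArg (fun x : Socket _ => (x.2 : ℕ)) h⟩
    · exact (Fin.heq_ext_iff (congrArg (fun v => deg v.1) h₁)).2 h₂
  rw [h]
  rfl

end Counting

end LDPC

/-! ### Rationality of the bit error probability -/

namespace LDPC

open scoped Classical

lemma factorial_mul_descFactorial_div {E K r : ℕ} (hr : r ≤ K) (hK : K ≤ E) :
    ((E - r).factorial : ℝ) * (E.descFactorial K / E.factorial) =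
      (E - r).descFactorial (K - r) := by
  have h₁ := Nat.factorial_mul_descFactorial hK
  have h₂ := Nat.factorial_mul_descFactorial (Nat.sub_le_sub_right hK r)
  rw [Nat.sub_sub_sub_cancel_right hr] at h₂
  have h₃ : (E.factorial : ℝ) ≠ 0 := Nat.cast_ne_zero.2 E.factorial_ne_zero
  rw [← mul_div_assoc, div_eq_iff h₃]
  norm_cast
  rw [← h₁, ← h₂]
  ring

/-- The contribution of a tuple of variable-node sockets with kernel `κ` and of a tuple of
check-node sockets with kernel `κ'` to the bit error probability. The relations `μ` and `ν` are the
kernels of the tuples of variable nodes and of check nodes, and `E` is the number of edges. The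
function `W` of the pattern is multiplied by the probability that all variable nodes of the tuple are
erased, and by the probability that the random matching joins the two tuples. The latter is scaled by
the falling factorial of `E` of length `Fintype.card J`, which makes it a polynomial in `E`. -/
noncomputable def matchingWeight {J : Type} [Fintype J] (W : Pattern J → ℝ)
    (κ μ κ' ν : J → J → Prop) (E : ℕ) (ε : ℝ) : ℝ :=
  if κ = κ' then ((E - numClasses κ).descFactorial (Fintype.card J - numClasses κ) : ℝ) *
    (W (fun i j => (κ i j, μ i j, ν i j)) * ε ^ numClasses μ) else 0

/-- The average over the edge set turns the sum over tuples of edges into a sum over pairs of tuples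
of sockets, which no longer involves the matching. -/
lemma exists_ensembleBitError_eq (Δ t : ℕ) : ∃ (J : Type) (_ : Fintype J) (W : Pattern J → ℝ),
    ∀ {V C : Type} [Fintype V] [Fintype C] [Nonempty V] {dv : V → ℕ} {dc : C → ℕ},
      (∀ v, dv v ≤ Δ) → (∀ v, 0 < dv v) → (∀ c, dc c ≤ Δ) →
      Fintype.card (Socket dc) = Fintype.card (Socket dv) →
      Fintype.card J ≤ Fintype.card (Socket dv) → ∀ ε : ℝ,
      ensembleBitError dv dc ε t *
          (Fintype.card V * (Fintype.card (Socket dv)).descFactorial (Fintype.card J)) =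
        ∑ y : J → Socket dv, ∑ z : J → Socket dc,
          matchingWeight W (fun i j => y i = y j) (fun i j => (y i).1 = (y j).1)
            (fun i j => z i = z j) (fun i j => (z i).1 = (z j).1) (Fintype.card (Socket dv)) ε := by
  obtain ⟨J, _, W, hW⟩ := exists_codeBitError_eq Δ t
  refine ⟨J, inferInstance, W, fun {V C} _ _ _ {dv dc} hv hv₀ hc hE hJ ε => ?_⟩
  have hV : (Fintype.card V : ℝ) ≠ 0 := Nat.cast_ne_zero.2 Fintype.card_ne_zero
  have hcard : Fintype.card (EdgeSet dv dc) = (Fintype.card (Socket dv)).factorial :=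
    Fintype.card_equiv (Fintype.equivOfCardEq hE.symm)
  rw [ensembleBitError, hcard, Finset.sum_congr rfl fun σ _ => hW hv hv₀ hc σ ε,
    ← Finset.sum_div, Finset.sum_comm]
  have hy : ∀ y : J → Socket dv, _ := fun y => sum_equiv_comp hE.symm y fun z =>
    W (fun i j => (y i = y j, (y i).1 = (y j).1, (z i).1 = (z j).1)) *
      ε ^ numClasses fun i j => (y i).1 = (y j).1
  simp only [Function.comp_apply] at hy
  rw [Finset.sum_congr rfl fun y _ => hy y]
  generalize hE' : Fintype.card (Socket dv) = E at *
  rw [show ∀ a b c d : ℝ, b ≠ 0 → a / b / c * (b * d) = a * (d / c) from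
    fun a b c d hb => by field_simp]
  · rw [Finset.sum_mul]
    refine Finset.sum_congr rfl fun y _ => ?_
    rw [Finset.sum_mul]
    refine Finset.sum_congr rfl fun z _ => ?_
    rw [matchingWeight]
    split_ifs with hyz
    · rw [← factorial_mul_descFactorial_div (numClasses_le _) hJ]
      ring
    · rw [zero_mul]
  · exact hV

lemma IsPolyOn.matchingWeight {B : Set ℕ} {E : ℕ → ℕ} (hE : IsPolyOn B fun n _ => (E n : ℝ))
    {J : Type} [Fintype J] (hJ : ∀ n ∈ B, Fintype.card J ≤ E n) (W : Pattern J → ℝ)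
    (κ μ κ' ν : J → J → Prop) : IsPolyOn B fun n ε => matchingWeight W κ μ κ' ν (E n) ε := by
  unfold LDPC.matchingWeight
  split_ifs
  · exact (IsPolyOn.descFactorial hE _ _ fun n hn => (numClasses_le κ).trans (hJ n hn)).mul
      ((IsPolyOn.const _).mul (IsPolyOn.pow_right _))
  · exact IsPolyOn.const 0

namespace IsDegreeDistribution

variable {p : ℝ[X]}

lemma sum_coeff (hp : IsDegreeDistribution p) : ∑ i : p.support, p.coeff i = 1 := by
  rw [← hp.sum_one, eval_eq_sum, Polynomial.sum, Finset.sum_coe_sort p.support fun i => p.coeff i]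
  simp

lemma eval_derivative (p : ℝ[X]) :
    (derivative p).eval 1 = ∑ i : p.support, p.coeff i * (i : ℕ) := by
  rw [derivative_eval, Polynomial.sum, Finset.sum_coe_sort p.support fun i => p.coeff i * (i : ℕ)]
  simp

lemma pos_of_mem (hp : IsDegreeDistribution p) (i : p.support) : 0 < (i : ℕ) := by
  refine Nat.pos_of_ne_zero fun h => mem_support_iff.1 i.2 ?_
  rw [h, hp.coeff_zero]

lemma one_le_eval_derivative (hp : IsDegreeDistribution p) : 1 ≤ (derivative p).eval 1 := by
  rw [eval_derivative, ← hp.sum_coeff]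
  exact Finset.sum_le_sum fun i _ => le_mul_of_one_le_right (hp.nonneg i)
    (Nat.one_le_cast.2 (hp.pos_of_mem i))

lemma card_node (hp : IsDegreeDistribution p) {a : ℝ} (ha : ∀ i, ∃ k : ℕ, a * p.coeff i = k) :
    (Fintype.card (Node p a) : ℝ) = a := by
  have h : ∀ i : p.support, (⌊a * p.coeff i⌋₊ : ℝ) = a * p.coeff i := fun i => by
    obtain ⟨k, hk⟩ := ha i
    rw [hk, Nat.floor_natCast]
  simp only [Fintype.card_sigma, Fintype.card_fin, Nat.cast_sum, h, ← Finset.mul_sum, hp.sum_coeff,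
    mul_one]

end IsDegreeDistribution

lemma card_socket_node {p : ℝ[X]} {a : ℝ} (ha : ∀ i, ∃ k : ℕ, a * p.coeff i = k) :
    (Fintype.card (Socket (Node.deg : Node p a → ℕ)) : ℝ) = a * (derivative p).eval 1 := by
  have h : ∀ i : p.support, (⌊a * p.coeff i⌋₊ : ℝ) = a * p.coeff i := fun i => by
    obtain ⟨k, hk⟩ := ha i
    rw [hk, Nat.floor_natCast]
  have h' : Fintype.card (Socket (Node.deg : Node p a → ℕ)) =
      ∑ i : p.support, ⌊a * p.coeff i⌋₊ * (i : ℕ) := by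
    rw [Fintype.card_sigma, Fintype.sum_sigma]
    refine Finset.sum_congr rfl fun i _ => ?_
    change ∑ _ : Fin ⌊a * p.coeff i⌋₊, Fintype.card (Fin (i : ℕ)) = _
    simp
  rw [h', IsDegreeDistribution.eval_derivative, Finset.mul_sum]
  push_cast
  simp only [h, mul_assoc]

lemma codeBitError_mem_Icc {V C : Type} [Fintype V] {dv : V → ℕ} {dc : C → ℕ}
    (σ : EdgeSet dv dc) {ε : ℝ} (hε : ε ∈ Set.Icc (0 : ℝ) 1) (t : ℕ) :
    codeBitError σ ε t ∈ Set.Icc (0 : ℝ) 1 := by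
  have hw : ∀ S : Finset V, 0 ≤ ε ^ S.card * (1 - ε) ^ (Fintype.card V - S.card) := fun S =>
    mul_nonneg (pow_nonneg hε.1 _) (pow_nonneg (sub_nonneg.2 hε.2) _)
  have h₁ : ∑ S : Finset V, ε ^ S.card * (1 - ε) ^ (Fintype.card V - S.card) = 1 := by
    simpa using sum_superset_bernoulli (∅ : Finset V) ε
  constructor
  · refine div_nonneg (Finset.sum_nonneg fun v _ => Finset.sum_nonneg fun S _ => ?_)
      (Nat.cast_nonneg _)
    split_ifs
    exacts [hw S, le_rfl]
  · refine div_le_one_of_le₀ ?_ (Nat.cast_nonneg _)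
    calc ∑ v : V, ∑ S : Finset V, (if BitErased σ S t v then
            ε ^ S.card * (1 - ε) ^ (Fintype.card V - S.card) else 0)
        ≤ ∑ v : V, (1 : ℝ) := Finset.sum_le_sum fun v _ => by
          refine le_of_le_of_eq (Finset.sum_le_sum fun S _ => ?_) h₁
          split_ifs
          exacts [le_rfl, hw S]
      _ = Fintype.card V := by simp

lemma ensembleBitError_mem_Icc {V C : Type} [Fintype V] [Fintype C] (dv : V → ℕ) (dc : C → ℕ)
    {ε : ℝ} (hε : ε ∈ Set.Icc (0 : ℝ) 1) (t : ℕ) :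
    ensembleBitError dv dc ε t ∈ Set.Icc (0 : ℝ) 1 := by
  constructor
  · exact div_nonneg (Finset.sum_nonneg fun σ _ => (codeBitError_mem_Icc σ hε t).1)
      (Nat.cast_nonneg _)
  · refine div_le_one_of_le₀ ?_ (Nat.cast_nonneg _)
    refine (Finset.sum_le_sum fun σ _ => (codeBitError_mem_Icc σ hε t).2).trans_eq ?_
    rw [Finset.sum_const, Finset.card_univ, nsmul_eq_mul, mul_one]

/-- The number of edges of the graphs of blocklength `n`. -/
noncomputable def numEdges (L : ℝ[X]) (n : ℕ) : ℕ := Fintype.card (Socket (Node.deg : Node L n → ℕ))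

variable {L R : ℝ[X]}

lemma IsBlocklength.numEdges_eq {n : ℕ} (h : IsBlocklength L R n) :
    (numEdges L n : ℝ) = (derivative L).eval 1 * n := by
  rw [numEdges, card_socket_node h.var_int, mul_comm]

lemma IsBlocklength.card_checkSocket (hR : IsDegreeDistribution R) {n : ℕ}
    (h : IsBlocklength L R n) :
    Fintype.card (Socket (Node.deg : Node R (numChecks L R n) → ℕ)) = numEdges L n := by
  have h₀ : (derivative R).eval 1 ≠ 0 := (zero_lt_one.trans_le hR.one_le_eval_derivative).ne'
  rw [← Nat.cast_inj (R := ℝ), card_socket_node h.check_int, h.numEdges_eq, numChecks,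
    div_mul_cancel₀ _ h₀, mul_comm]

/-- The bit error probability is a rational function of the blocklength. -/
lemma exists_isPolyOn_Pb (hL : IsDegreeDistribution L) (hR : IsDegreeDistribution R) (t : ℕ) :
    ∃ K : ℕ, IsPolyOn {n | IsBlocklength L R n ∧ K ≤ numEdges L n} fun n ε =>
      Pb L R n ε t * (n * (numEdges L n).descFactorial K) := by
  obtain ⟨J, _, W, hW⟩ := exists_ensembleBitError_eq (max L.natDegree R.natDegree) t
  refine ⟨Fintype.card J, ?_⟩
  set B : Set ℕ := {n | IsBlocklength L R n ∧ Fintype.card J ≤ numEdges L n}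
  have hNat : ∀ c : ℝ, IsPolyOn B fun n _ => c * n := fun c =>
    (IsPolyOn.const c).mul IsPolyOn.natCast
  have hN : ∀ d : L.support, IsPolyOn B fun n _ => (⌊(n : ℝ) * L.coeff d⌋₊ : ℝ) := fun d =>
    (hNat (L.coeff d)).congr fun n hn _ => by
      obtain ⟨k, hk⟩ := hn.1.var_int d
      rw [hk, Nat.floor_natCast, ← hk, mul_comm]
  have hN' : ∀ d : R.support, IsPolyOn B fun n _ => (⌊numChecks L R n * R.coeff d⌋₊ : ℝ) :=
    fun d => (hNat ((derivative L).eval 1 / (derivative R).eval 1 * R.coeff d)).congr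
      fun n hn _ => by
        obtain ⟨k, hk⟩ := hn.1.check_int d
        rw [hk, Nat.floor_natCast, ← hk, numChecks]
        ring
  have hE : IsPolyOn B fun n _ => (numEdges L n : ℝ) :=
    (hNat ((derivative L).eval 1)).congr fun n hn _ => hn.1.numEdges_eq
  refine (isPolyOn_sum_socket hN (fun d => (d : ℕ)) _ fun κ μ =>
    isPolyOn_sum_socket hN' (fun d => (d : ℕ))
      (fun κ' ν n ε => matchingWeight W κ μ κ' ν (numEdges L n) ε)
      fun κ' ν => IsPolyOn.matchingWeight hE (fun n hn => hn.2) W κ μ κ' ν).congr fun n hn ε => ?_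
  have hcard := hL.card_node hn.1.var_int
  have : Nonempty (Node L n) := Fintype.card_pos_iff.1 <| by
    rw [Nat.cast_inj.1 hcard]
    exact hn.1.pos
  have h := hW (V := Node L n) (C := Node R (numChecks L R n)) (dv := Node.deg) (dc := Node.deg)
    (fun v => (le_natDegree_of_mem_supp _ v.1.2).trans (le_max_left _ _))
    (fun v => hL.pos_of_mem v.1)
    (fun c => (le_natDegree_of_mem_supp _ c.1.2).trans (le_max_right _ _))
    (hn.1.card_checkSocket hR) hn.2 ε
  rw [hcard] at h
  exact h

end LDPC

/-! ### Expansion of bounded rational functions -/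

namespace LDPC

lemma _root_.AnalyticAt.exists_isBigO_sq {φ : ℝ → ℝ} (h : AnalyticAt ℝ φ 0) :
    ∃ a b : ℝ, (fun x => φ x - a - b * x) =O[𝓝 0] fun x => x ^ 2 := by
  obtain ⟨p, hp⟩ := h
  refine ⟨p.coeff 0, p.coeff 1, ?_⟩
  have := hp.isBigO_sub_partialSum_pow 2
  simp only [zero_add, FormalMultilinearSeries.partialSum, Finset.sum_range_succ,
    Finset.range_zero, Finset.sum_empty, FormalMultilinearSeries.apply_eq_pow_smul_coeff,
    smul_eq_mul, pow_zero, pow_one, one_mul, Real.norm_eq_abs, sq_abs] at this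
  refine this.congr_left fun x => ?_
  ring

/-- A bounded rational function of `n` with a denominator of degree `K + 1` has an expansion in
powers of `1 / n`. Boundedness forces the degree of the numerator to be at most `K + 1`. -/
lemma exists_expansion {B : Set ℕ} (hB : ∃ᶠ n in atTop, n ∈ B) (hpos : ∀ n ∈ B, 0 < n)
    {f : ℕ → ℝ → ℝ} (hf : ∀ n ∈ B, ∀ ε ∈ Set.Icc (0 : ℝ) 1, f n ε ∈ Set.Icc (0 : ℝ) 1)
    {lam : ℝ} (hlam : 1 ≤ lam) {E : ℕ → ℕ} (hE : ∀ n ∈ B, (E n : ℝ) = lam * n) {K : ℕ}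
    (hpoly : IsPolyOn {n | n ∈ B ∧ K ≤ E n} fun n ε => f n ε * (n * (E n).descFactorial K)) :
    ∃ (a b : ℝ → ℝ) (c : ℝ), 0 < c ∧ (∀ ε ∈ Set.Icc (0 : ℝ) 1, |b ε| ≤ c) ∧
      ∀ n ∈ B, ∀ ε ∈ Set.Icc (0 : ℝ) 1, |f n ε - a ε - b ε / n| ≤ c / n ^ 2 := by
  obtain ⟨p, hp⟩ := hpoly
  have hKE : ∀ n ∈ B, K ≤ n → K ≤ E n := fun n hn h => by
    have : (n : ℝ) ≤ E n := by
      rw [hE n hn]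
      exact le_mul_of_one_le_left (Nat.cast_nonneg n) hlam
    exact h.trans (Nat.cast_le.1 this)
  let P : ℝ → ℝ[X] := fun ε => p.map (evalRingHom ε)
  have hP : ∀ n ∈ B, K ≤ n → ∀ ε, (P ε).eval (n : ℝ) = f n ε * (n * (E n).descFactorial K) :=
    fun n hn h ε => by
      exact (map_evalRingHom_eval ε n p).trans (hp n ⟨hn, hKE n hn h⟩ ε).symm
  -- Otherwise `P ε / X ^ (K + 1)` would be unbounded, whereas `f n ε` is at most `1`.
  have hdeg : ∀ ε ∈ Set.Icc (0 : ℝ) 1, (P ε).natDegree < K + 2 := by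
    intro ε hε
    by_contra! hlt
    have hd : (X ^ (K + 1) : ℝ[X]).degree < (P ε).degree := by
      rw [degree_X_pow]
      exact (Nat.cast_lt.2 (Nat.lt_of_succ_le hlt)).trans_le (degree_eq_natDegree (fun h => by
        rw [h, natDegree_zero] at hlt
        omega)).ge
    have htend := (abs_div_tendsto_atTop_atTop_of_degree_gt (P ε) _ hd
      (pow_ne_zero _ X_ne_zero)).comp (tendsto_natCast_atTop_atTop (R := ℝ))
    obtain ⟨n, hnB, hn, hKn⟩ := (hB.and_eventually
      ((htend.eventually_gt_atTop (lam ^ K)).and (eventually_ge_atTop K))).exists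
    refine absurd hn (not_lt.2 ?_)
    have hn₀ : (0 : ℝ) < n := Nat.cast_pos.2 (hpos n hnB)
    have hle : ((E n).descFactorial K : ℝ) ≤ (lam * n) ^ K := by
      rw [← hE n hnB]
      exact_mod_cast Nat.descFactorial_le_pow (E n) K
    rw [Function.comp_apply, eval_pow, eval_X, hP n hnB hKn, abs_div,
      abs_of_nonneg (mul_nonneg (hf n hnB ε hε).1 (by positivity)), abs_of_pos (pow_pos hn₀ _),
      div_le_iff₀ (pow_pos hn₀ _)]
    calc f n ε * (n * ((E n).descFactorial K : ℝ)) ≤ 1 * (n * (lam * n) ^ K) := by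
          gcongr
          exact (hf n hnB ε hε).2
      _ = lam ^ K * n ^ (K + 1) := by ring
  -- At `x = 1 / n`, the value of `φ j` is `n ^ j / (n * (E n).descFactorial K)`.
  let φ : ℕ → ℝ → ℝ := fun j x => x ^ (K + 1 - j) / ∏ i ∈ Finset.range K, (lam - i * x)
  have hφ : ∀ j, AnalyticAt ℝ (φ j) 0 := fun j => by
    refine AnalyticAt.div (by fun_prop) (Finset.analyticAt_fun_prod _ fun i _ => by fun_prop) ?_
    simp only [mul_zero, sub_zero, Finset.prod_const]
    exact pow_ne_zero _ (by linarith)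
  choose α β hαβ using fun j => (hφ j).exists_isBigO_sq
  have hfφ : ∀ n ∈ B, K ≤ n → ∀ ε ∈ Set.Icc (0 : ℝ) 1,
      f n ε = ∑ j ∈ Finset.range (K + 2), (P ε).coeff j * φ j (n : ℝ)⁻¹ := by
    intro n hn hKn ε hε
    have hn₀ : (n : ℝ) ≠ 0 := Nat.cast_ne_zero.2 (hpos n hn).ne'
    have hdF : ((E n).descFactorial K : ℝ) = ∏ i ∈ Finset.range K, (lam * n - i) := by
      rw [← descPochhammer_eval_eq_descFactorial, descPochhammer_eval_eq_prod_range, hE n hn]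
    have hdF₀ : ∏ i ∈ Finset.range K, (lam * n - i) ≠ 0 := by
      rw [← hdF, Nat.cast_ne_zero]
      exact (Nat.descFactorial_pos.2 (hKE n hn hKn)).ne'
    have h := hP n hn hKn ε
    rw [hdF, eval_eq_sum_range' (hdeg ε hε)] at h
    rw [← mul_div_cancel_right₀ (f n ε) (mul_ne_zero hn₀ hdF₀), ← h, Finset.sum_div]
    refine Finset.sum_congr rfl fun j hj => ?_
    have hj' : j ≤ K + 1 := Nat.lt_succ_iff.1 (Finset.mem_range.1 hj)
    have hprod : ∏ i ∈ Finset.range K, (lam * n - i) =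
        n ^ K * ∏ i ∈ Finset.range K, (lam - i * (n : ℝ)⁻¹) := by
      rw [← Finset.card_range K, ← Finset.prod_const, Finset.card_range, ← Finset.prod_mul_distrib]
      refine Finset.prod_congr rfl fun i _ => ?_
      field_simp
    rw [hprod] at hdF₀ ⊢
    have hQ := right_ne_zero_of_mul hdF₀
    simp only [φ]
    rw [mul_div_assoc, ← mul_assoc, ← pow_succ', inv_pow]
    congr 1
    generalize ∏ i ∈ Finset.range K, (lam - i * (n : ℝ)⁻¹) = Q at hQ ⊢
    rw [← pow_mul_pow_sub _ hj']
    field_simp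
  have hbound : ∃ M : ℝ, 0 ≤ M ∧ ∀ j ∈ Finset.range (K + 2), ∀ ε ∈ Set.Icc (0 : ℝ) 1,
      |(P ε).coeff j| ≤ M := by
    have : ∀ j, ∃ M : ℝ, ∀ ε ∈ Set.Icc (0 : ℝ) 1, |(P ε).coeff j| ≤ M := fun j => by
      obtain ⟨M, hM⟩ := isCompact_Icc.exists_bound_of_continuousOn
        (p.coeff j).continuous.continuousOn (s := Set.Icc (0 : ℝ) 1)
      exact ⟨M, fun ε hε => by simpa [P] using hM ε hε⟩
    choose M hM using this
    refine ⟨∑ j ∈ Finset.range (K + 2), |M j|, by positivity, fun j hj ε hε => ?_⟩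
    exact ((hM j ε hε).trans (le_abs_self _)).trans
      (Finset.single_le_sum (f := fun j => |M j|) (fun i _ => abs_nonneg _) hj)
  obtain ⟨M, hM₀, hM⟩ := hbound
  have hsum : ∀ γ : ℕ → ℝ, ∀ ε ∈ Set.Icc (0 : ℝ) 1,
      |∑ j ∈ Finset.range (K + 2), (P ε).coeff j * γ j| ≤
        M * ∑ j ∈ Finset.range (K + 2), |γ j| := by
    intro γ ε hε
    rw [Finset.mul_sum]
    refine (Finset.abs_sum_le_sum_abs _ _).trans (Finset.sum_le_sum fun j hj => ?_)
    rw [abs_mul]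
    exact mul_le_mul_of_nonneg_right (hM j hj ε hε) (abs_nonneg _)
  have hO : (fun n : ℕ => M * ∑ j ∈ Finset.range (K + 2),
      |φ j (n : ℝ)⁻¹ - α j - β j * (n : ℝ)⁻¹|) =O[atTop] fun n : ℕ => ((n : ℝ)⁻¹) ^ 2 :=
    (Asymptotics.IsBigO.fun_sum fun j _ =>
      ((hαβ j).comp_tendsto (tendsto_inv_atTop_nhds_zero_nat (𝕜 := ℝ))).abs_left).const_mul_left M
  obtain ⟨c₀, hc₀⟩ := hO.bound
  obtain ⟨n₀, hn₀⟩ := eventually_atTop.1 (hc₀.and (eventually_ge_atTop K))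
  let Ma := M * ∑ j ∈ Finset.range (K + 2), |α j|
  let Mb := M * ∑ j ∈ Finset.range (K + 2), |β j|
  have hMa : 0 ≤ Ma := by positivity
  have hMb : 0 ≤ Mb := by positivity
  refine ⟨fun ε => ∑ j ∈ Finset.range (K + 2), (P ε).coeff j * α j,
    fun ε => ∑ j ∈ Finset.range (K + 2), (P ε).coeff j * β j,
    |c₀| + (1 + Ma + Mb) * n₀ ^ 2 + Mb + 1, by positivity, fun ε hε => ?_, fun n hn ε hε => ?_⟩
  · have : 0 ≤ (1 + Ma + Mb) * (n₀ : ℝ) ^ 2 := by positivity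
    linarith [hsum β ε hε, abs_nonneg c₀]
  have hnp : (0 : ℝ) < n := Nat.cast_pos.2 (hpos n hn)
  have hn1 : (1 : ℝ) ≤ n := Nat.one_le_cast.2 (hpos n hn)
  -- The Taylor estimate holds for `n ≥ n₀`; for the smaller `n` all terms are bounded.
  rcases le_or_gt n₀ n with h | h
  · obtain ⟨h₁, h₂⟩ := hn₀ n h
    rw [hfφ n hn h₂ ε hε, Finset.sum_div, ← Finset.sum_sub_distrib, ← Finset.sum_sub_distrib]
    calc _ = |∑ j ∈ Finset.range (K + 2), (P ε).coeff j *
            (φ j (n : ℝ)⁻¹ - α j - β j * (n : ℝ)⁻¹)| := by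
          congr 1
          refine Finset.sum_congr rfl fun j _ => ?_
          rw [div_eq_mul_inv]
          ring
      _ ≤ c₀ * ((n : ℝ)⁻¹) ^ 2 := by
          refine (hsum _ ε hε).trans ((le_abs_self _).trans (h₁.trans_eq ?_))
          rw [Real.norm_of_nonneg (by positivity)]
      _ = c₀ / n ^ 2 := by rw [inv_pow, div_eq_mul_inv]
      _ ≤ _ := by
          gcongr
          have : 0 ≤ (1 + Ma + Mb) * (n₀ : ℝ) ^ 2 := by positivity
          linarith [le_abs_self c₀]
  · rw [le_div_iff₀ (by positivity)]
    have h₁ : |f n ε| ≤ 1 := abs_le.2 ⟨by linarith [(hf n hn ε hε).1], (hf n hn ε hε).2⟩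
    have h₂ := hsum α ε hε
    have h₃ : |(∑ j ∈ Finset.range (K + 2), (P ε).coeff j * β j) / n| ≤ Mb := by
      rw [abs_div, abs_of_pos hnp]
      exact (div_le_self (abs_nonneg _) hn1).trans (hsum β ε hε)
    have h₄ : |f n ε - ∑ j ∈ Finset.range (K + 2), (P ε).coeff j * α j -
        (∑ j ∈ Finset.range (K + 2), (P ε).coeff j * β j) / n| ≤ 1 + Ma + Mb :=
      (abs_sub _ _).trans (add_le_add ((abs_sub _ _).trans (add_le_add h₁ h₂)) h₃)
    have h₅ : (n : ℝ) ^ 2 ≤ (n₀ : ℝ) ^ 2 := by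
      gcongr
    have := mul_le_mul h₄ h₅ (by positivity) (by positivity)
    linarith [abs_nonneg c₀]

end LDPC

/-! ### Blocklengths and the limits -/

namespace LDPC

lemma IsBlocklength.mul_left {L R : ℝ[X]} {n : ℕ} (h : IsBlocklength L R n) {k : ℕ} (hk : 0 < k) :
    IsBlocklength L R (k * n) where
  pos := Nat.mul_pos hk h.pos
  var_int i := by
    obtain ⟨a, ha⟩ := h.var_int i
    exact ⟨k * a, by push_cast; rw [mul_assoc, ha]⟩
  check_int j := by
    obtain ⟨a, ha⟩ := h.check_int j
    refine ⟨k * a, ?_⟩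
    push_cast
    rw [← ha, numChecks, numChecks]
    push_cast
    ring

lemma frequently_isBlocklength {L R : ℝ[X]} (hn : ∃ n, IsBlocklength L R n) :
    ∃ᶠ n in atTop, IsBlocklength L R n := by
  obtain ⟨n, h⟩ := hn
  exact frequently_atTop.2 fun a =>
    ⟨(a + 1) * n, (Nat.le_succ a).trans (Nat.le_mul_of_pos_right _ h.pos), h.mul_left a.succ_pos⟩

lemma neBot_blocklengths {L R : ℝ[X]} (hn : ∃ n, IsBlocklength L R n) :
    (blocklengths L R).NeBot :=
  frequently_mem_iff_neBot.1 (frequently_isBlocklength hn)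

end LDPC

theorem mainTheorem4 (L R : ℝ[X]) (hL : LDPC.IsDegreeDistribution L)
    (hR : LDPC.IsDegreeDistribution R) (hn : ∃ n, LDPC.IsBlocklength L R n) (t : ℕ) :
    (∀ ε ∈ Set.Icc (0 : ℝ) 1,
      Tendsto (fun n => LDPC.Pb L R n ε t) (LDPC.blocklengths L R) (𝓝 (LDPC.PbInf L R ε t)) ∧
      Tendsto (fun n : ℕ => (n : ℝ) * (LDPC.Pb L R n ε t - LDPC.PbInf L R ε t))
        (LDPC.blocklengths L R) (𝓝 (LDPC.alpha L R ε t))) ∧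
    (∃ D : ℕ → ℝ,
      Asymptotics.IsTheta (LDPC.blocklengths L R) D (fun n => ((n : ℝ) ^ 2)⁻¹) ∧
      ∀ n, LDPC.IsBlocklength L R n → ∀ ε ∈ Set.Icc (0 : ℝ) 1,
        |LDPC.Pb L R n ε t - LDPC.PbInf L R ε t - LDPC.alpha L R ε t / n| ≤ D n) ∧
    TendstoUniformlyOn (fun n ε => LDPC.Pb L R n ε t) (fun ε => LDPC.PbInf L R ε t)
      (LDPC.blocklengths L R) (Set.Icc (0 : ℝ) 1) := by
  open LDPC in
  have := neBot_blocklengths hn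
  obtain ⟨K, hK⟩ := exists_isPolyOn_Pb hL hR t
  obtain ⟨a, b, c, hc, hb, hab⟩ := exists_expansion (B := {n | IsBlocklength L R n})
    (f := fun n ε => Pb L R n ε t) (frequently_isBlocklength hn) (fun n h => h.pos)
    (fun n _ ε hε => ensembleBitError_mem_Icc _ _ hε t) hL.one_le_eval_derivative
    (fun n h => h.numEdges_eq) hK
  have hmem : ∀ᶠ n in blocklengths L R, IsBlocklength L R n :=
    mem_inf_of_right (mem_principal_self _)
  have hinv : Tendsto (fun n : ℕ => (n : ℝ)⁻¹) (blocklengths L R) (𝓝 0) :=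
    (tendsto_inv_atTop_nhds_zero_nat (𝕜 := ℝ)).mono_left inf_le_left
  -- By `hab` and the bound `hb` on the coefficient of `1 / n`, convergence is uniform.
  have hunif : TendstoUniformlyOn (fun n ε => Pb L R n ε t) a (blocklengths L R)
      (Set.Icc (0 : ℝ) 1) := by
    have hlim : Tendsto (fun n : ℕ => c * (n : ℝ)⁻¹ + c * (n : ℝ)⁻¹ ^ 2) (blocklengths L R)
        (𝓝 0) := by
      simpa using (hinv.const_mul c).add ((hinv.pow 2).const_mul c)
    refine Metric.tendstoUniformlyOn_iff.2 fun δ hδ => ?_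
    filter_upwards [hmem, hlim.eventually_lt_const hδ] with n h hlt ε hε
    have h₁ := hab n h ε hε
    rw [div_eq_mul_inv, div_eq_mul_inv, ← inv_pow] at h₁
    have h₂ : |b ε * (n : ℝ)⁻¹| ≤ c * (n : ℝ)⁻¹ := by
      rw [abs_mul, abs_inv, Nat.abs_cast]
      exact mul_le_mul_of_nonneg_right (hb ε hε) (inv_nonneg.2 (Nat.cast_nonneg n))
    have h₃ := abs_add_le (b ε * (n : ℝ)⁻¹) (Pb L R n ε t - a ε - b ε * (n : ℝ)⁻¹)
    rw [add_sub_cancel] at h₃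
    rw [dist_comm, Real.dist_eq]
    linarith
  have h₁ : ∀ ε ∈ Set.Icc (0 : ℝ) 1,
      Tendsto (fun n => Pb L R n ε t) (blocklengths L R) (𝓝 (a ε)) := fun ε hε =>
    hunif.tendsto_at hε
  have hInf : ∀ ε ∈ Set.Icc (0 : ℝ) 1, PbInf L R ε t = a ε := fun ε hε =>
    (h₁ ε hε).limUnder_eq
  have h₂ : ∀ ε ∈ Set.Icc (0 : ℝ) 1, Tendsto
      (fun n : ℕ => (n : ℝ) * (Pb L R n ε t - PbInf L R ε t)) (blocklengths L R) (𝓝 (b ε)) := by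
    intro ε hε
    have hlim : Tendsto (fun n : ℕ => c * (n : ℝ)⁻¹) (blocklengths L R) (𝓝 0) := by
      simpa using hinv.const_mul c
    refine tendsto_iff_norm_sub_tendsto_zero.2 (squeeze_zero' (.of_forall fun n => norm_nonneg _)
      (hmem.mono fun n h => ?_) hlim)
    have hn₀ : (0 : ℝ) < n := Nat.cast_pos.2 h.pos
    rw [hInf ε hε, Real.norm_eq_abs]
    calc |n * (Pb L R n ε t - a ε) - b ε| = n * |Pb L R n ε t - a ε - b ε / n| := by
          rw [← abs_of_pos hn₀, ← abs_mul, abs_of_pos hn₀]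
          congr 1
          field_simp
      _ ≤ n * (c / n ^ 2) := by
          gcongr
          exact hab n h ε hε
      _ = c * (n : ℝ)⁻¹ := by field_simp
  have hAlpha : ∀ ε ∈ Set.Icc (0 : ℝ) 1, alpha L R ε t = b ε := fun ε hε =>
    (h₂ ε hε).limUnder_eq
  refine ⟨fun ε hε => ⟨hInf ε hε ▸ h₁ ε hε, hAlpha ε hε ▸ h₂ ε hε⟩,
    ⟨fun n => c / n ^ 2, ?_, fun n h ε hε => ?_⟩, hunif.congr_right fun ε hε => (hInf ε hε).symm⟩
  · simp only [div_eq_mul_inv]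
    exact (Asymptotics.isTheta_refl _ _).const_mul_left hc.ne'
  · rw [hInf ε hε, hAlpha ε hε]
    exact hab n h ε hε
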